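/- **Setting.** Let $G=(N,T,P)$ be a context-free grammar: $N$ and $T$ are finite disjoint sets of non-terminals and terminals, $P$ is a finite set of rules $X\to\eta$ with $X\in N$ and $\eta\in\vartheta:=(N\cup T)^*$, and every non-terminal is the left-hand side of some rule. Let $N=N_{\mathrm{ref}}\,\dot\cup\,N_{\mathrm{prov}}$ be a partition into the non-terminals owned by *refuter* and by *prover*. A sentential form $\alpha\in\vartheta$ is owned by the owner of its leftmost non-terminal; terminal words are owned by refuter. Let $A$ be a nondeterministic finite automaton over $T$ with finite state set $Q$, a set $I\subseteq Q$ of initial states (in particular, a single initial state $I=\{q_0\}$), a set $Q_F\subseteq Q$ of final states, and language $L(A)\subseteq T^*$. **Game.** The positions are the sentential forms. A move replaces the leftmost non-terminal $X$ of the position by $\eta$ for some rule $X\to\eta$; it is chosen by the owner of the position. A play is a finite (non-empty) or infinite path of moves. It is maximal if it is infinite or ends in a terminal word. A maximal play satisfies inclusion if it is infinite or ends in a word of $L(A)$; it satisfies non-inclusion if it is finite and ends in a word of $T^*\setminus L(A)$. Prover wants inclusion, refuter wants non-inclusion. A strategy of a player maps each non-maximal play ending in a position of that player to a successor of this position. It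 is winning from $\alpha$ if every maximal play that starts in $\alpha$ and conforms to the strategy satisfies the player's winning condition. The winning region of a player is the set of positions from which she has a winning strategy. **Formulas.** A box is a relation $\rho\subseteq Q\times Q$. Boxes are composed by relational composition $\rho;\tau$, with neutral element $\mathrm{id}$. The box of $a\in T$ is $\rho_a=\{(q,q') : q\xrightarrow{a}q'\}$. Consider negation-free Boolean formulas (built with $\wedge,\vee$ and the constant $\mathsf{false}$) with boxes as propositions, taken modulo logical equivalence and ordered by implication. Relational composition of formulas is given on boxes by $\rho;\tau$, and by $F;\mathsf{false}=\mathsf{false};F=\mathsf{false}$, $(F_1\star F_2);F=(F_1;F)\star(F_2;F)$ and $\rho;(F_1\star F_2)=(\rho;F_1)\star(\rho;F_2)$ for $\star\in\{\wedge,\vee\}$. A valuation $v$ of the non-terminals by classes of formulas extends to sentential forms by $v(\varepsilon)=\mathrm{id}$, $v(a)=\rho_a$ for $a\in T$, and $v(\alpha\beta)=v(\alpha);v(\beta)$. Let $f$ be the operator on valuations with $$f(v)(X)=\bigwedge_{X\to\eta}v(\eta)\ \text{ if } X\in N_{\mathrm{prov}},\qquad f(v)(X)=\bigvee_{X\to\eta}v(\eta)\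 \text{ if } X\in N_{\mathrm{ref}}.$$ A class of formulas is *rejecting* if it is true under the assignment $\nu$ that makes a box $\rho$ true if and only if $\rho$ contains no pair in $I\times Q_F$. **Theorem.** The system of equations $v=f(v)$ has a least solution $\sigma$ with respect to pointwise implication, and $\sigma=f^i(\bot)$ for all sufficiently large $i$, where $\bot$ assigns $\mathsf{false}$ to every non-terminal. Put $$W_{\mathrm{incl}}=\{\alpha\in\vartheta : \sigma(\alpha)\text{ is not rejecting}\},\qquad W_{\mathrm{nonincl}}=\{\alpha\in\vartheta : \sigma(\alpha)\text{ is rejecting}\}.$$ Then inclusion games are determined: $\vartheta=W_{\mathrm{incl}}\,\dot\cup\,W_{\mathrm{nonincl}}$, where $W_{\mathrm{incl}}$ is exactly the winning region of prover and $W_{\mathrm{nonincl}}$ is exactly the winning region of refuter. Consequently, for every $\alpha\in\vartheta$, refuter has a winning strategy from $\alpha$ if $\sigma(\alpha)$ evaluates to true under $\nu$, and prover has one otherwise. -/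

import Mathlib

namespace InclusionGame

/-! ## Grammars with ownership, arena -/

/-- The two players: refuter (circle) and prover (square). -/
inductive Player
  | refuter
  | prover

/-- Sentential forms: words over terminals and non-terminals. -/
abbrev Form (T N : Type*) := List (Symbol T N)

/-- A context-free grammar with ownership partitioning: finitely many rules, every non-terminal is
the left-hand side of some rule, and every non-terminal is owned by one of the players. -/
structure OwnedCFG (T N : Type*) where
  rules : Finset (ContextFreeRule T N)
  owner : N → Player
  exists_rule : ∀ X : N, ∃ r ∈ rules, r.input = X

/-- A terminal word, seen as a sentential form. -/
def word {T : Type*} (N : Type*) (w : List T) : Form T N := w.map Symbol.terminal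

/-- The sentential form is a terminal word. -/
def IsWord {T N : Type*} (α : Form T N) : Prop := ∃ w : List T, α = word N w

namespace OwnedCFG

variable {T N : Type*} (G : OwnedCFG T N)

/-- The left-derivation relation: the leftmost non-terminal is replaced according to a rule. -/
def Derives (α β : Form T N) : Prop :=
  ∃ r ∈ G.rules, ∃ (w : List T) (γ : Form T N),
    α = word N w ++ Symbol.nonterminal r.input :: γ ∧ β = word N w ++ r.output ++ γ

/-- The owner of a sentential form is the owner of its leftmost non-terminal; refuter owns all
terminal words. -/
def formOwner : Form T N → Player
  | [] => Player.refuter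
  | Symbol.terminal _ :: α => formOwner α
  | Symbol.nonterminal X :: _ => G.owner X

open Classical in
/-- The set of right-hand sides of the rules for `X`. -/
noncomputable def rhs (X : N) : Finset (Form T N) :=
  (G.rules.filter fun r => r.input = X).image ContextFreeRule.output

theorem rhs_nonempty (X : N) : (G.rhs X).Nonempty := by
  classical
  obtain ⟨r, hr, hX⟩ := G.exists_rule X
  exact ⟨r.output, Finset.mem_image.2 ⟨r, Finset.mem_filter.2 ⟨hr, hX⟩, rfl⟩⟩

/-! ## Plays, strategies, winning regions -/

/-- A finite play: a non-empty finite path in the arena. -/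
structure FinPlay where
  positions : List (Form T N)
  ne_nil : positions ≠ []
  chain : positions.IsChain G.Derives

/-- The first position of a finite play. -/
def FinPlay.first {G : OwnedCFG T N} (p : G.FinPlay) : Form T N := p.positions.head p.ne_nil

/-- The last position of a finite play. -/
def FinPlay.last {G : OwnedCFG T N} (p : G.FinPlay) : Form T N := p.positions.getLast p.ne_nil

/-- A play is a finite or an infinite path in the arena. -/
inductive Play
  | fin (p : G.FinPlay)
  | inf (p : ℕ → Form T N) (step : ∀ i, G.Derives (p i) (p (i + 1)))

namespace Play

variable {G}

/-- The position in which a play starts. -/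
def first : G.Play → Form T N
  | fin p => p.first
  | inf p _ => p 0

/-- A play is maximal if it is infinite or ends in a terminal word. -/
def IsMaximal : G.Play → Prop
  | fin p => IsWord p.last
  | inf _ _ => True

/-- The list `l` consists of the first `l.length` positions of the play. -/
def HasPrefix : G.Play → List (Form T N) → Prop
  | fin p, l => l <+: p.positions
  | inf p _, l => l = (List.range l.length).map p

/-- The inclusion winning condition (for maximal plays). -/
def Inclusion {Q : Type*} (A : NFA T Q) : G.Play → Prop
  | fin p => ∃ w ∈ A.accepts, p.last = word N w
  | inf _ _ => True

/-- The non-inclusion winning condition (for maximal plays). -/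
def NonInclusion {Q : Type*} (A : NFA T Q) : G.Play → Prop
  | fin p => ∃ w ∈ (A.accepts)ᶜ, p.last = word N w
  | inf _ _ => False

/-- The winning condition of a player: prover wants inclusion, refuter wants non-inclusion. -/
def WonBy {Q : Type*} (A : NFA T Q) : Player → G.Play → Prop
  | Player.prover => Inclusion A
  | Player.refuter => NonInclusion A

end Play

/-- A strategy of a player maps every non-maximal (hence finite) play that ends in a position owned
by the player to a successor of this last position. -/
def Strategy (pl : Player) :=
  (p : G.FinPlay) → ¬ IsWord p.last → G.formOwner p.last = pl → {β : Form T N // G.Derives p.last β}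

/-- A play conforms to a strategy if, whenever it is the turn of the player, the next position of
the play is the one returned by the strategy on the play up to now. -/
def Play.Conforms {G : OwnedCFG T N} {pl : Player} (p : G.Play) (s : G.Strategy pl) : Prop :=
  ∀ (q : G.FinPlay) (β : Form T N), p.HasPrefix (q.positions ++ [β]) →
    ∀ (hq : ¬ IsWord q.last) (ho : G.formOwner q.last = pl), (s q hq ho : Form T N) = β

/-- A strategy is winning from `α` if every maximal play from `α` that conforms to it satisfies the
winning condition of the player. -/
def Strategy.IsWinningFrom {G : OwnedCFG T N} {pl : Player} {Q : Type*} (A : NFA T Q)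
    (s : G.Strategy pl) (α : Form T N) : Prop :=
  ∀ p : G.Play, p.IsMaximal → p.first = α → p.Conforms s → p.WonBy A pl

/-- The winning region of a player: all positions from which the player has a winning strategy. -/
def winningRegion {Q : Type*} (A : NFA T Q) (pl : Player) : Set (Form T N) :=
  {α | ∃ s : G.Strategy pl, s.IsWinningFrom A α}

end OwnedCFG

/-! ## Negation-free Boolean formulas -/

/-- Negation-free Boolean formulas over the propositions `B`, without constants. -/
inductive PosFormula (B : Type*)
  | atom (b : B)
  | and (F G : PosFormula B)
  | or (F G : PosFormula B)

/-- The value of a formula under an assignment. -/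
def PosFormula.eval {B : Type*} (ν : B → Prop) : PosFormula B → Prop
  | atom b => ν b
  | and F G => F.eval ν ∧ G.eval ν
  | or F G => F.eval ν ∨ G.eval ν

/-- Negation-free Boolean formulas over `B` including the constant `ff`. Conjunctions and
disjunctions involving `ff` are evaluated syntactically, so `ff` never occurs inside of another
formula. -/
inductive BF (B : Type*)
  | ff
  | pos (F : PosFormula B)

namespace BF

variable {B : Type*}

/-- Conjunction; `ff ∧ F = F ∧ ff = ff`. -/
def and : BF B → BF B → BF B
  | pos F, pos G => pos (F.and G)
  | ff, _ => ff
  | pos _, ff => ff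

/-- Disjunction; `ff ∨ F = F ∨ ff = F`. -/
def or : BF B → BF B → BF B
  | pos F, pos G => pos (F.or G)
  | ff, G => G
  | pos F, ff => pos F

/-- The value of a formula under an assignment. -/
def eval (ν : B → Prop) : BF B → Prop
  | ff => False
  | pos F => F.eval ν

theorem eval_and (ν : B → Prop) (F G : BF B) : (F.and G).eval ν ↔ F.eval ν ∧ G.eval ν := by
  cases F <;> cases G <;> simp [and, eval, PosFormula.eval]

theorem eval_or (ν : B → Prop) (F G : BF B) : (F.or G).eval ν ↔ F.eval ν ∨ G.eval ν := by
  cases F <;> cases G <;> simp [or, eval, PosFormula.eval]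

/-- Formulas are ordered by implication. -/
instance : Preorder (BF B) where
  le F G := ∀ ν : B → Prop, F.eval ν → G.eval ν
  le_refl _ _ h := h
  le_trans _ _ _ h₁ h₂ ν h := h₂ ν (h₁ ν h)

theorem le_def {F G : BF B} : F ≤ G ↔ ∀ ν : B → Prop, F.eval ν → G.eval ν := Iff.rfl

end BF

/-- Formulas modulo logical equivalence, partially ordered by implication of representatives. -/
abbrev BFE (B : Type*) := Antisymmetrization (BF B) (· ≤ ·)

namespace BFE

variable {B : Type*}

/-- The equivalence class of a formula. -/
def mk (F : BF B) : BFE B := toAntisymmetrization (· ≤ ·) F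

/-- The value of a class of formulas under an assignment. -/
def eval (ν : B → Prop) : BFE B → Prop :=
  Quotient.lift (BF.eval ν) fun _ _ h => propext ⟨h.1 ν, h.2 ν⟩

/-- Conjunction of classes. -/
def and : BFE B → BFE B → BFE B :=
  Quotient.map₂ BF.and fun _ _ h _ _ h' =>
    ⟨fun ν k => (BF.eval_and ν _ _).2 (((BF.eval_and ν _ _).1 k).imp (h.1 ν) (h'.1 ν)),
      fun ν k => (BF.eval_and ν _ _).2 (((BF.eval_and ν _ _).1 k).imp (h.2 ν) (h'.2 ν))⟩

/-- Disjunction of classes. -/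
def or : BFE B → BFE B → BFE B :=
  Quotient.map₂ BF.or fun _ _ h _ _ h' =>
    ⟨fun ν k => (BF.eval_or ν _ _).2 (((BF.eval_or ν _ _).1 k).imp (h.1 ν) (h'.1 ν)),
      fun ν k => (BF.eval_or ν _ _).2 (((BF.eval_or ν _ _).1 k).imp (h.2 ν) (h'.2 ν))⟩

@[simp] theorem eval_mk (ν : B → Prop) (F : BF B) : eval ν (mk F) = F.eval ν := rfl

theorem eval_and (ν : B → Prop) (F G : BFE B) : (F.and G).eval ν ↔ F.eval ν ∧ G.eval ν := by
  induction F using Quotient.inductionOn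
  induction G using Quotient.inductionOn
  exact BF.eval_and ν _ _

theorem eval_or (ν : B → Prop) (F G : BFE B) : (F.or G).eval ν ↔ F.eval ν ∨ G.eval ν := by
  induction F using Quotient.inductionOn
  induction G using Quotient.inductionOn
  exact BF.eval_or ν _ _

theorem le_iff {F G : BFE B} : F ≤ G ↔ ∀ ν : B → Prop, F.eval ν → G.eval ν := by
  induction F using Quotient.inductionOn
  induction G using Quotient.inductionOn
  exact Iff.rfl

/-- The partial order of classes of formulas is a lattice, in which the meet is conjunction and the
join is disjunction. -/
instance : Lattice (BFE B) where
  inf := and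
  sup := or
  inf_le_left F G := le_iff.2 fun ν h => ((eval_and ν F G).1 h).1
  inf_le_right F G := le_iff.2 fun ν h => ((eval_and ν F G).1 h).2
  le_inf _ G H h h' := le_iff.2 fun ν k => (eval_and ν G H).2 ⟨le_iff.1 h ν k, le_iff.1 h' ν k⟩
  le_sup_left F G := le_iff.2 fun ν h => (eval_or ν F G).2 (Or.inl h)
  le_sup_right F G := le_iff.2 fun ν h => (eval_or ν F G).2 (Or.inr h)
  sup_le F G _ h h' := le_iff.2 fun ν k => ((eval_or ν F G).1 k).elim (le_iff.1 h ν) (le_iff.1 h' ν)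

/-- The class of `ff` is the least element. -/
instance : OrderBot (BFE B) where
  bot := mk BF.ff
  bot_le _ := le_iff.2 fun _ h => False.elim h

theorem eval_injective : Function.Injective fun (F : BFE B) (ν : B → Prop) => F.eval ν := by
  intro F G h
  exact le_antisymm (le_iff.2 fun ν k => (congrFun h ν).mp k)
    (le_iff.2 fun ν k => (congrFun h ν).mpr k)

instance [Finite B] : Finite (BFE B) := Finite.of_injective _ eval_injective

end BFE

/-! ## Boxes and relational composition -/

/-- Boxes: relations over the states, with relational composition `SetRel.comp` and the identity
`SetRel.id`. -/
abbrev Box (Q : Type*) := SetRel Q Q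

/-- The box of a letter. -/
def letterBox {T Q : Type*} (A : NFA T Q) (a : T) : Box Q := {p | p.2 ∈ A.step p.1 a}

/-- The box `ρ` is rejecting if it contains no pair of an initial and a final state. -/
def IsRejectingBox {T Q : Type*} (A : NFA T Q) (ρ : Box Q) : Prop :=
  ¬ ∃ q ∈ A.start, ∃ q' ∈ A.accept, (q, q') ∈ ρ

namespace PosFormula

variable {Q : Type*}

/-- Composition of a box with a formula. -/
def boxComp (ρ : Box Q) : PosFormula (Box Q) → PosFormula (Box Q)
  | atom τ => atom (SetRel.comp ρ τ)
  | and G₁ G₂ => and (boxComp ρ G₁) (boxComp ρ G₂)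
  | or G₁ G₂ => or (boxComp ρ G₁) (boxComp ρ G₂)

/-- Relational composition of formulas that are not `ff`. -/
def comp : PosFormula (Box Q) → PosFormula (Box Q) → PosFormula (Box Q)
  | atom ρ, G => boxComp ρ G
  | and F₁ F₂, G => and (comp F₁ G) (comp F₂ G)
  | or F₁ F₂, G => or (comp F₁ G) (comp F₂ G)

theorem eval_boxComp (ν : Box Q → Prop) (ρ : Box Q) (G : PosFormula (Box Q)) :
    (boxComp ρ G).eval ν ↔ G.eval fun τ => ν (SetRel.comp ρ τ) := by
  induction G with
  | atom τ => exact Iff.rfl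
  | and G₁ G₂ h₁ h₂ => exact and_congr h₁ h₂
  | or G₁ G₂ h₁ h₂ => exact or_congr h₁ h₂

theorem eval_comp (ν : Box Q → Prop) (F G : PosFormula (Box Q)) :
    (comp F G).eval ν ↔ F.eval fun ρ => G.eval fun τ => ν (SetRel.comp ρ τ) := by
  induction F with
  | atom ρ => exact eval_boxComp ν ρ G
  | and F₁ F₂ h₁ h₂ => exact and_congr h₁ h₂
  | or F₁ F₂ h₁ h₂ => exact or_congr h₁ h₂

theorem eval_mono {B : Type*} {ν ν' : B → Prop} (h : ∀ b, ν b → ν' b) (F : PosFormula B) :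
    F.eval ν → F.eval ν' := by
  induction F with
  | atom b => exact h b
  | and F₁ F₂ h₁ h₂ => exact And.imp h₁ h₂
  | or F₁ F₂ h₁ h₂ => exact Or.imp h₁ h₂

theorem not_eval_false {B : Type*} (F : PosFormula B) : ¬ F.eval fun _ => False := by
  induction F with
  | atom b => exact id
  | and F₁ F₂ h₁ h₂ => exact fun h => h₁ h.1
  | or F₁ F₂ h₁ h₂ => exact fun h => h.elim h₁ h₂

end PosFormula

namespace BF

variable {Q : Type*}

/-- Relational composition of formulas; `F ; ff = ff ; G = ff`. -/
def comp : BF (Box Q) → BF (Box Q) → BF (Box Q)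
  | pos F, pos G => pos (F.comp G)
  | ff, _ => ff
  | pos _, ff => ff

theorem eval_comp (ν : Box Q → Prop) (F G : BF (Box Q)) :
    (comp F G).eval ν ↔ F.eval fun ρ => G.eval fun τ => ν (SetRel.comp ρ τ) := by
  cases F with
  | ff => exact Iff.rfl
  | pos F =>
    cases G with
    | ff => exact ⟨False.elim, F.not_eval_false⟩
    | pos G => exact PosFormula.eval_comp ν F G

theorem eval_mono {B : Type*} {ν ν' : B → Prop} (h : ∀ b, ν b → ν' b) (F : BF B) :
    F.eval ν → F.eval ν' := by
  cases F with
  | ff => exact id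
  | pos F => exact F.eval_mono h

theorem comp_mono {F F' G G' : BF (Box Q)} (h : F ≤ F') (h' : G ≤ G') :
    comp F G ≤ comp F' G' := fun ν k =>
  (eval_comp ν F' G').2 (F'.eval_mono (fun _ => h' _) (h _ ((eval_comp ν F G).1 k)))

end BF

namespace BFE

variable {Q : Type*}

/-- Relational composition of classes of formulas. -/
def comp : BFE (Box Q) → BFE (Box Q) → BFE (Box Q) :=
  Quotient.map₂ BF.comp fun _ _ h _ _ h' => ⟨BF.comp_mono h.1 h'.1, BF.comp_mono h.2 h'.2⟩

/-- The class of the formula that consists of a single box. -/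
def ofBox (ρ : Box Q) : BFE (Box Q) := mk (BF.pos (PosFormula.atom ρ))

theorem eval_comp (ν : Box Q → Prop) (F G : BFE (Box Q)) :
    (comp F G).eval ν ↔ F.eval fun ρ => G.eval fun τ => ν (SetRel.comp ρ τ) := by
  induction F using Quotient.inductionOn
  induction G using Quotient.inductionOn
  exact BF.eval_comp ν _ _

theorem comp_mono {F F' G G' : BFE (Box Q)} (h : F ≤ F') (h' : G ≤ G') :
    comp F G ≤ comp F' G' := by
  induction F using Quotient.inductionOn
  induction G using Quotient.inductionOn
  induction F' using Quotient.inductionOn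
  induction G' using Quotient.inductionOn
  exact BF.comp_mono h h'

theorem comp_assoc (F G H : BFE (Box Q)) : comp (comp F G) H = comp F (comp G H) := by
  apply eval_injective
  funext ν
  simp only [eval_comp, SetRel.comp_assoc]

theorem id_comp (F : BFE (Box Q)) : comp (ofBox SetRel.id) F = F := by
  apply eval_injective
  funext ν
  simp [eval_comp, ofBox, BF.eval, PosFormula.eval]

theorem comp_id (F : BFE (Box Q)) : comp F (ofBox SetRel.id) = F := by
  apply eval_injective
  funext ν
  simp [eval_comp, ofBox, BF.eval, PosFormula.eval]

/-- A class of formulas is rejecting if it is satisfied under the assignment that makes exactly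
the rejecting boxes true. -/
def IsRejecting {T : Type*} (A : NFA T Q) (F : BFE (Box Q)) : Prop := F.eval (IsRejectingBox A)

end BFE

/-! ## The system of equations and its least solution -/

/-- The value of a symbol, given the values of the non-terminals. -/
def symbolValue {T N Q : Type*} (A : NFA T Q) (v : N → BFE (Box Q)) : Symbol T N → BFE (Box Q)
  | Symbol.terminal a => BFE.ofBox (letterBox A a)
  | Symbol.nonterminal X => v X

/-- The extension of a valuation `v` of the non-terminals to sentential forms: concatenation
becomes relational composition, the empty word becomes the identity box. -/
def formValue {T N Q : Type*} (A : NFA T Q) (v : N → BFE (Box Q)) : Form T N → BFE (Box Q)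
  | [] => BFE.ofBox SetRel.id
  | x :: α => BFE.comp (symbolValue A v x) (formValue A v α)

theorem formValue_singleton {T N Q : Type*} (A : NFA T Q) (v : N → BFE (Box Q)) (x : Symbol T N) :
    formValue A v [x] = symbolValue A v x :=
  BFE.comp_id _

theorem formValue_append {T N Q : Type*} (A : NFA T Q) (v : N → BFE (Box Q)) (α β : Form T N) :
    formValue A v (α ++ β) = BFE.comp (formValue A v α) (formValue A v β) := by
  induction α with
  | nil => exact (BFE.id_comp _).symm
  | cons x α ih => simp only [List.cons_append, formValue, ih, BFE.comp_assoc]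

theorem formValue_mono {T N Q : Type*} (A : NFA T Q) {v v' : N → BFE (Box Q)} (h : v ≤ v')
    (α : Form T N) : formValue A v α ≤ formValue A v' α := by
  induction α with
  | nil => exact le_rfl
  | cons x α ih =>
    refine BFE.comp_mono ?_ ih
    cases x with
    | terminal a => exact le_rfl
    | nonterminal X => exact h X

/-- A monotone self-map of a finite partial order with a least element has a least fixed point. -/
theorem exists_isLeast_fixedPoints {D : Type*} [PartialOrder D] [OrderBot D] [Finite D]
    {f : D → D} (hf : Monotone f) : ∃ x, IsLeast (Function.fixedPoints f) x := by
  obtain ⟨n, hn⟩ := WellFoundedGT.monotone_chain_condition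
    (⟨fun i => f^[i] ⊥, hf.monotone_iterate_of_le_map bot_le⟩ : ℕ →o D)
  refine ⟨f^[n] ⊥, ?_, fun y hy => ?_⟩
  · have h := hn (n + 1) n.le_succ
    simp only [OrderHom.coe_mk, Function.iterate_succ_apply'] at h
    exact h.symm
  · have h := hf.iterate n (bot_le (a := y))
    rwa [Function.iterate_fixed hy n] at h

namespace OwnedCFG

variable {T N Q : Type*} (G : OwnedCFG T N) (A : NFA T Q)

/-- The right-hand side of the system of equations: the value of `X` is the conjunction (if prover
owns `X`) or the disjunction (if refuter owns `X`) of the values of the right-hand sides of all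
rules for `X`. -/
noncomputable def system (v : N → BFE (Box Q)) (X : N) : BFE (Box Q) :=
  match G.owner X with
  | Player.prover => (G.rhs X).inf' (G.rhs_nonempty X) (formValue A v)
  | Player.refuter => (G.rhs X).sup' (G.rhs_nonempty X) (formValue A v)

theorem system_mono : Monotone (G.system A) := by
  intro v v' h X
  unfold system
  cases G.owner X with
  | prover => exact Finset.inf'_mono_fun fun η _ => formValue_mono A h η
  | refuter => exact Finset.sup'_mono_fun fun η _ => formValue_mono A h η

variable [Finite N] [Finite Q]

theorem exists_leastSolution : ∃ σ, IsLeast (Function.fixedPoints (G.system A)) σ :=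
  exists_isLeast_fixedPoints (G.system_mono A)

/-- The least solution of the system of equations. -/
noncomputable def sol : N → BFE (Box Q) := (G.exists_leastSolution A).choose

theorem isLeast_sol : IsLeast (Function.fixedPoints (G.system A)) (G.sol A) :=
  (G.exists_leastSolution A).choose_spec

/-- The formula (up to equivalence) that the least solution assigns to a sentential form. -/
noncomputable def formSol (α : Form T N) : BFE (Box Q) := formValue A (G.sol A) α

/-- The sentential forms whose formula is not rejecting. -/
def inclRegion : Set (Form T N) := {α | ¬ (G.formSol A α).IsRejecting A}

/-- The sentential forms whose formula is rejecting. -/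
def nonInclRegion : Set (Form T N) := {α | (G.formSol A α).IsRejecting A}

end OwnedCFG

end InclusionGame

/-! Composition of formulas acts like sequencing: `F ; G` holds under `ν` iff `F` holds under the
assignment that makes `ρ` true when `G` holds under `τ ↦ ν (ρ ; τ)`. The part of a form to the right
of a symbol is thus a continuation, and the terminal prefix to its left contributes a single box.
Hence at any solution of the equations the value of a form is the conjunction (prover) or
disjunction (refuter) of the values of its successors: `eval_formValue_prover`,
`eval_formValue_refuter`.

If the value at the least solution is not rejecting, prover can therefore keep it so forever.
Infinite plays are hers, and a word whose box is not rejecting is accepted, so this safety argument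
suffices (`mem_winningRegion_prover`). It uses only that `σ` is a solution.

Leastness matters for refuter, who must force termination. Since `σ` is a finite iterate of the
system from `⊥`, a rejecting value unfolds into a bounded attractor to non-accepted words
(`exists_attractor_of_eval_iterate`), and lowering the attractor rank with each move wins
(`mem_winningRegion_refuter`).

The two regions cover all forms by definition. A play conforming to a strategy of each player shows
that the winning regions are disjoint, which turns both inclusions into equalities. -/

namespace InclusionGame

variable {T N Q : Type*}

/-! ## Boxes of words and acceptance -/

/-- The box of a terminal word. -/
def wordBox (A : NFA T Q) : List T → Box Q
  | [] => SetRel.id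
  | a :: w => SetRel.comp (letterBox A a) (wordBox A w)

theorem wordBox_append (A : NFA T Q) (u w : List T) :
    wordBox A (u ++ w) = SetRel.comp (wordBox A u) (wordBox A w) := by
  induction u with
  | nil => simp [wordBox]
  | cons a u ih => simp [wordBox, ih, SetRel.comp_assoc]

/-- The set `S` is arbitrary because reading a letter replaces it in the induction. -/
theorem mem_evalFrom_iff (A : NFA T Q) (w : List T) (S : Set Q) (q' : Q) :
    q' ∈ A.evalFrom S w ↔ ∃ q ∈ S, (q, q') ∈ wordBox A w := by
  induction w generalizing S with
  | nil => simp [wordBox]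
  | cons a w ih =>
    rw [NFA.evalFrom_cons, ih]
    simp only [NFA.mem_stepSet, wordBox, SetRel.mem_comp, letterBox, Set.mem_ofPred_eq]
    constructor
    · rintro ⟨r, ⟨q, hq, hr⟩, h⟩
      exact ⟨q, hq, r, hr, h⟩
    · rintro ⟨q, hq, r, hr, h⟩
      exact ⟨r, ⟨q, hq, hr⟩, h⟩

theorem isRejectingBox_wordBox (A : NFA T Q) (w : List T) :
    IsRejectingBox A (wordBox A w) ↔ w ∈ (A.accepts)ᶜ := by
  have h : w ∈ A.accepts ↔ ∃ q ∈ A.start, ∃ q' ∈ A.accept, (q, q') ∈ wordBox A w := by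
    rw [NFA.mem_accepts]
    simp only [mem_evalFrom_iff]
    constructor
    · rintro ⟨q', h', q, h, k⟩
      exact ⟨q, h, q', h', k⟩
    · rintro ⟨q, h, q', h', k⟩
      exact ⟨q', h', q, h, k⟩
  exact (not_congr h).symm

/-! ## Evaluation of formulas -/

namespace BFE

theorem eval_ofBox {B : Type*} (ν : Box B → Prop) (ρ : Box B) : (ofBox ρ).eval ν ↔ ν ρ := Iff.rfl

theorem not_eval_bot {B : Type*} (ν : B → Prop) : ¬ (⊥ : BFE B).eval ν := id

theorem eval_inf' {B ι : Type*} (ν : B → Prop) (s : Finset ι) (hs : s.Nonempty) (F : ι → BFE B) :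
    (s.inf' hs F).eval ν ↔ ∀ i ∈ s, (F i).eval ν := by
  induction hs using Finset.Nonempty.cons_induction with
  | singleton a => simp
  | cons a s h hs ih =>
    rw [Finset.inf'_cons hs, Finset.forall_mem_cons, ← ih]
    exact eval_and ν _ _

theorem eval_sup' {B ι : Type*} (ν : B → Prop) (s : Finset ι) (hs : s.Nonempty) (F : ι → BFE B) :
    (s.sup' hs F).eval ν ↔ ∃ i ∈ s, (F i).eval ν := by
  induction hs using Finset.Nonempty.cons_induction with
  | singleton a => simp
  | cons a s h hs ih =>
    rw [Finset.sup'_cons hs]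
    simp only [Finset.mem_cons, or_and_right, exists_or, exists_eq_left, ← ih]
    exact eval_or ν _ _

end BFE

theorem formValue_word (A : NFA T Q) (v : N → BFE (Box Q)) (w : List T) :
    formValue A v (word N w) = BFE.ofBox (wordBox A w) := by
  induction w with
  | nil => rfl
  | cons a w ih =>
    change BFE.comp (BFE.ofBox (letterBox A a)) (formValue A v (word N w)) = _
    rw [ih]
    rfl

/-- The value of a form, seen as a function of the box of its middle part. -/
theorem eval_formValue_word_append_append (A : NFA T Q) (v : N → BFE (Box Q)) (ν : Box Q → Prop)
    (w : List T) (η γ : Form T N) :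
    (formValue A v (word N w ++ η ++ γ)).eval ν ↔ (formValue A v η).eval fun ρ =>
      (formValue A v γ).eval fun τ => ν (SetRel.comp (wordBox A w) (SetRel.comp ρ τ)) := by
  rw [List.append_assoc, formValue_append, formValue_append, formValue_word, BFE.eval_comp,
    BFE.eval_ofBox, BFE.eval_comp]

/-! ## Leftmost non-terminals -/

theorem word_injective : Function.Injective (word N : List T → Form T N) :=
  List.map_injective_iff.2 fun _ _ h => Symbol.terminal.inj h

theorem exists_leftmost {α : Form T N} (h : ¬ IsWord α) :
    ∃ (w : List T) (X : N) (γ : Form T N), α = word N w ++ Symbol.nonterminal X :: γ := by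
  induction α with
  | nil => exact (h ⟨[], rfl⟩).elim
  | cons x α ih =>
    cases x with
    | nonterminal X => exact ⟨[], X, α, rfl⟩
    | terminal a =>
      obtain ⟨w, X, γ, rfl⟩ := ih fun ⟨w, hw⟩ => h ⟨a :: w, by rw [hw]; rfl⟩
      exact ⟨a :: w, X, γ, rfl⟩

/-- Makes the decomposition hidden in the existential of `Derives` canonical, so that moves
correspond to the rules for one fixed non-terminal. -/
theorem leftmost_unique {w w' : List T} {X X' : N} {γ γ' : Form T N}
    (h : word N w ++ Symbol.nonterminal X :: γ = word N w' ++ Symbol.nonterminal X' :: γ') :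
    w = w' ∧ X = X' ∧ γ = γ' := by
  induction w generalizing w' with
  | nil => cases w' <;> simp_all [word]
  | cons a w ih =>
    cases w' with
    | nil => simp [word] at h
    | cons b w' =>
      simp only [word, List.map_cons, List.cons_append, List.cons.injEq,
        Symbol.terminal.injEq] at h
      obtain ⟨rfl, h⟩ := h
      obtain ⟨rfl, rfl, rfl⟩ := ih h
      exact ⟨rfl, rfl, rfl⟩

theorem not_isWord_leftmost (w : List T) (X : N) (γ : Form T N) :
    ¬ IsWord (word N w ++ Symbol.nonterminal X :: γ) := by
  rintro ⟨u, hu⟩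
  have h : Symbol.nonterminal X ∈ word N u := hu ▸ by simp
  simp [word] at h

namespace OwnedCFG

variable (G : OwnedCFG T N) (A : NFA T Q)

theorem formOwner_leftmost (w : List T) (X : N) (γ : Form T N) :
    G.formOwner (word N w ++ Symbol.nonterminal X :: γ) = G.owner X := by
  induction w with
  | nil => rfl
  | cons a w ih => exact ih

theorem derives_leftmost_iff (w : List T) (X : N) (γ β : Form T N) :
    G.Derives (word N w ++ Symbol.nonterminal X :: γ) β ↔
      ∃ η ∈ G.rhs X, β = word N w ++ η ++ γ := by
  classical
  simp only [rhs, Finset.mem_image, Finset.mem_filter]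
  constructor
  · rintro ⟨r, hr, w', γ', h, rfl⟩
    obtain ⟨rfl, rfl, rfl⟩ := leftmost_unique h
    exact ⟨r.output, ⟨r, ⟨hr, rfl⟩, rfl⟩, rfl⟩
  · rintro ⟨_, ⟨r, ⟨hr, rfl⟩, rfl⟩, rfl⟩
    exact ⟨r, hr, w, γ, rfl, rfl⟩

variable {G} in
theorem Derives.not_isWord {α β : Form T N} (h : G.Derives α β) : ¬ IsWord α := by
  obtain ⟨r, -, w, γ, rfl, -⟩ := h
  exact not_isWord_leftmost w r.input γ

theorem exists_derives {α : Form T N} (h : ¬ IsWord α) : ∃ β, G.Derives α β := by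
  obtain ⟨w, X, γ, rfl⟩ := exists_leftmost h
  obtain ⟨η, hη⟩ := G.rhs_nonempty X
  exact ⟨_, (G.derives_leftmost_iff w X γ _).2 ⟨η, hη, rfl⟩⟩

theorem finite_derives (α : Form T N) : {β | G.Derives α β}.Finite := by
  by_cases h : IsWord α
  · exact Set.Finite.subset Set.finite_empty fun β hβ => hβ.not_isWord h
  · obtain ⟨w, X, γ, rfl⟩ := exists_leftmost h
    refine ((G.rhs X).finite_toSet.image fun η => word N w ++ η ++ γ).subset fun β hβ => ?_
    obtain ⟨η, hη, rfl⟩ := (G.derives_leftmost_iff w X γ β).1 hβ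
    exact ⟨η, hη, rfl⟩

/-! ## The system of equations -/

theorem eval_system_prover {X : N} (h : G.owner X = Player.prover) (v : N → BFE (Box Q))
    (ν : Box Q → Prop) :
    (G.system A v X).eval ν ↔ ∀ η ∈ G.rhs X, (formValue A v η).eval ν := by
  simp only [system, h, BFE.eval_inf']

theorem eval_system_refuter {X : N} (h : G.owner X = Player.refuter) (v : N → BFE (Box Q))
    (ν : Box Q → Prop) :
    (G.system A v X).eval ν ↔ ∃ η ∈ G.rhs X, (formValue A v η).eval ν := by
  simp only [system, h, BFE.eval_sup']

theorem eval_formValue_leftmost (v : N → BFE (Box Q)) (ν : Box Q → Prop) (w : List T) (X : N)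
    (γ : Form T N) :
    (formValue A v (word N w ++ Symbol.nonterminal X :: γ)).eval ν ↔ (v X).eval fun ρ =>
      (formValue A v γ).eval fun τ => ν (SetRel.comp (wordBox A w) (SetRel.comp ρ τ)) := by
  have h := eval_formValue_word_append_append A v ν w [Symbol.nonterminal X] γ
  rwa [formValue_singleton, List.append_assoc] at h

/-- Left of the non-terminal there is only a word, whose value is one box, so the context merely
changes the assignment under which `v X` is read, and the conjunction in the equation for `X` passes
through. With a general formula on the left this distributivity would fail. -/
theorem eval_formValue_prover {v : N → BFE (Box Q)} (hv : G.system A v = v) {α : Form T N}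
    (hα : ¬ IsWord α) (h : G.formOwner α = Player.prover) (ν : Box Q → Prop) :
    (formValue A v α).eval ν ↔ ∀ β, G.Derives α β → (formValue A v β).eval ν := by
  obtain ⟨w, X, γ, rfl⟩ := exists_leftmost hα
  rw [formOwner_leftmost] at h
  simp only [eval_formValue_leftmost, derives_leftmost_iff, forall_exists_index, and_imp]
  rw [← congrFun hv X, G.eval_system_prover A h]
  constructor
  · rintro k β η hη rfl
    exact (eval_formValue_word_append_append A v ν w η γ).2 (k η hη)
  · exact fun k η hη => (eval_formValue_word_append_append A v ν w η γ).1 (k _ η hη rfl)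

theorem eval_formValue_refuter {v : N → BFE (Box Q)} (hv : G.system A v = v) {α : Form T N}
    (hα : ¬ IsWord α) (h : G.formOwner α = Player.refuter) (ν : Box Q → Prop) :
    (formValue A v α).eval ν ↔ ∃ β, G.Derives α β ∧ (formValue A v β).eval ν := by
  obtain ⟨w, X, γ, rfl⟩ := exists_leftmost hα
  rw [formOwner_leftmost] at h
  simp only [eval_formValue_leftmost, derives_leftmost_iff]
  rw [← congrFun hv X, G.eval_system_refuter A h]
  constructor
  · rintro ⟨η, hη, k⟩
    exact ⟨_, ⟨η, hη, rfl⟩, (eval_formValue_word_append_append A v ν w η γ).2 k⟩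
  · rintro ⟨_, ⟨η, hη, rfl⟩, k⟩
    exact ⟨η, hη, (eval_formValue_word_append_append A v ν w η γ).1 k⟩

/-- `sol` is only chosen as some least fixed point. The increasing iterates from `⊥` become
stationary in a finite order; their limit is a fixed point and lies below every other, so it is
`sol`. -/
theorem exists_iterate_eq_sol [Finite N] [Finite Q] :
    ∃ n : ℕ, ∀ i ≥ n, (G.system A)^[i] ⊥ = G.sol A := by
  have hf := G.system_mono A
  obtain ⟨n, hn⟩ := WellFoundedGT.monotone_chain_condition
    (⟨fun i => (G.system A)^[i] ⊥, hf.monotone_iterate_of_le_map bot_le⟩ :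
      ℕ →o (N → BFE (Box Q)))
  refine ⟨n, fun i hi => (hn i hi).symm.trans (le_antisymm ?_ ?_)⟩
  · have h := hf.iterate n (bot_le (a := G.sol A))
    rwa [Function.iterate_fixed (G.isLeast_sol A).1 n] at h
  · refine (G.isLeast_sol A).2 ?_
    have h := hn (n + 1) n.le_succ
    simp only [OrderHom.coe_mk, Function.iterate_succ_apply'] at h
    exact h.symm

/-! ## The attractor of refuter -/

/-- The positions from which refuter can enforce within `n` moves that the play ends in a word
outside of the language. -/
def Attractor : ℕ → Form T N → Prop
  | 0, α => ∃ w ∈ (A.accepts)ᶜ, α = word N w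
  | n + 1, α => Attractor n α ∨
      ¬ IsWord α ∧ (G.formOwner α = Player.refuter ∧ (∃ β, G.Derives α β ∧ Attractor n β) ∨
        G.formOwner α = Player.prover ∧ ∀ β, G.Derives α β → Attractor n β)

theorem attractor_mono {m n : ℕ} (h : m ≤ n) {α : Form T N} (hα : G.Attractor A m α) :
    G.Attractor A n α := by
  induction h with
  | refl => exact hα
  | step _ ih => exact Or.inl ih

/-- Prover has only finitely many moves, so the ranks of the successors have a common bound. -/
theorem exists_attractor_of_prover {α : Form T N} (hα : ¬ IsWord α)
    (h : G.formOwner α = Player.prover)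
    (k : ∀ β, G.Derives α β → ∃ n, G.Attractor A n β) : ∃ n, G.Attractor A n α := by
  choose! r hr using k
  obtain ⟨M, hM⟩ := ((G.finite_derives α).image r).bddAbove
  exact ⟨M + 1, Or.inr ⟨hα, Or.inr ⟨h, fun β hβ =>
    G.attractor_mono A (hM ⟨β, hβ, rfl⟩) (hr β hβ)⟩⟩⟩

theorem exists_attractor_of_refuter {α β : Form T N} (h : G.formOwner α = Player.refuter)
    (hβ : G.Derives α β) (k : ∃ n, G.Attractor A n β) : ∃ n, G.Attractor A n α := by
  obtain ⟨n, hn⟩ := k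
  exact ⟨n + 1, Or.inr ⟨hβ.not_isWord, Or.inl ⟨h, β, hβ, hn⟩⟩⟩

/-- Continuation-passing induction. `K` is a condition on the box of the word `u` that has replaced
`w ++ η`, strong enough for refuter to win on from `u` followed by `γ`. The outer induction on `i`
pays for replacing a non-terminal by a right-hand side; the inner one consumes `η` from left to
right. -/
theorem exists_attractor_of_eval_iterate (i : ℕ) (η : Form T N) (w : List T) (γ : Form T N)
    (K : Box Q → Prop)
    (hK : ∀ u, K (wordBox A u) → ∃ n, G.Attractor A n (word N u ++ γ))
    (h : (formValue A ((G.system A)^[i] ⊥) η).eval fun τ => K (SetRel.comp (wordBox A w) τ)) :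
    ∃ n, G.Attractor A n (word N w ++ η ++ γ) := by
  induction i generalizing η w γ K with
  | zero =>
    induction η generalizing w with
    | nil =>
      rw [List.append_nil]
      refine hK w ?_
      simpa [formValue, BFE.eval_ofBox] using h
    | cons x η ih =>
      rw [formValue, BFE.eval_comp] at h
      cases x with
      | terminal a =>
        -- A letter is not a move; it joins the finished prefix.
        have := ih (w ++ [a]) (by
          simpa [symbolValue, BFE.eval_ofBox, wordBox_append, wordBox, SetRel.comp_assoc] using h)
        simpa [word] using this
      -- At stage 0 non-terminals have the value `⊥`, so none can occur here.
      | nonterminal X => exact (BFE.not_eval_bot _ h).elim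
  | succ i hi =>
    induction η generalizing w with
    | nil =>
      rw [List.append_nil]
      refine hK w ?_
      simpa [formValue, BFE.eval_ofBox] using h
    | cons x η ih =>
      rw [formValue, BFE.eval_comp] at h
      cases x with
      | terminal a =>
        have := ih (w ++ [a]) (by
          simpa [symbolValue, BFE.eval_ofBox, wordBox_append, wordBox, SetRel.comp_assoc] using h)
        simpa [word] using this
      | nonterminal X =>
        have key : ∀ ξ : Form T N, ((formValue A ((G.system A)^[i] ⊥) ξ).eval fun ρ =>
            (formValue A ((G.system A)^[i + 1] ⊥) η).eval fun τ =>
              K (SetRel.comp (wordBox A w) (SetRel.comp ρ τ))) →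
            ∃ n, G.Attractor A n (word N w ++ ξ ++ (η ++ γ)) := by
          intro ξ hξ
          -- The right-hand side `ξ` is read at stage `i`; the remainder `η`, still at stage `i +
          -- 1`, moves into its continuation. Once `ξ` has become a word, the inner hypothesis for
          -- `η` takes over with the longer prefix `u`.
          refine hi ξ w (η ++ γ) (fun ρ => (formValue A ((G.system A)^[i + 1] ⊥) η).eval fun τ =>
            K (SetRel.comp ρ τ)) (fun u hu => ?_) ?_
          · rw [← List.append_assoc]
            exact ih u hu
          · simpa only [SetRel.comp_assoc] using hξ
        rw [symbolValue, Function.iterate_succ_apply'] at h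
        rw [List.append_assoc, List.cons_append]
        cases hX : G.owner X with
        | prover =>
          rw [G.eval_system_prover A hX] at h
          refine G.exists_attractor_of_prover A (not_isWord_leftmost w X _)
            ((G.formOwner_leftmost w X _).trans hX) fun β hβ => ?_
          obtain ⟨ξ, hξ, rfl⟩ := (G.derives_leftmost_iff w X _ β).1 hβ
          exact key ξ (by simpa only [Function.iterate_succ_apply'] using h ξ hξ)
        | refuter =>
          rw [G.eval_system_refuter A hX] at h
          obtain ⟨ξ, hξ, h⟩ := h
          exact G.exists_attractor_of_refuter A ((G.formOwner_leftmost w X _).trans hX)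
            ((G.derives_leftmost_iff w X _ _).2 ⟨ξ, hξ, rfl⟩)
            (key ξ (by simpa only [Function.iterate_succ_apply'] using h))

theorem exists_attractor_of_mem_nonInclRegion [Finite N] [Finite Q] {α : Form T N}
    (h : α ∈ G.nonInclRegion A) : ∃ n, G.Attractor A n α := by
  obtain ⟨i, hi⟩ := G.exists_iterate_eq_sol A
  -- Prefix and remainder are empty; the final continuation is the rejecting assignment, which on
  -- word boxes means non-acceptance, that is, rank 0.
  have := G.exists_attractor_of_eval_iterate A i α [] [] (IsRejectingBox A)
    (fun u hu => ⟨0, u, (isRejectingBox_wordBox A u).1 hu, by simp⟩)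
    (by
      rw [hi i le_rfl]
      simp only [wordBox, SetRel.id_comp]
      exact h)
  simpa [word] using this

/-! ## Positional strategies -/

variable {G} in
/-- A play in which the positions of the player are always followed by the successor that `g`
chooses. -/
def Play.Follows (p : G.Play) (pl : Player) (g : Form T N → Form T N) : Prop :=
  match p with
  | fin p => p.positions.IsChain fun α β => G.formOwner α = pl → β = g α
  | inf p _ => ∀ i, G.formOwner (p i) = pl → p (i + 1) = g (p i)

/-- The strategy that chooses the successor according to the last position of the play. -/
def positional (pl : Player) (g : Form T N → Form T N)
    (hg : ∀ α, ¬ IsWord α → G.formOwner α = pl → G.Derives α (g α)) : G.Strategy pl :=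
  fun q hq ho => ⟨g q.last, hg _ hq ho⟩

/-- A positional strategy sees only the last position, so conformance on the prefix ending at index
`i` constrains exactly the step from `i` to `i + 1`. -/
theorem follows_of_conforms {pl : Player} {g : Form T N → Form T N}
    {hg : ∀ α, ¬ IsWord α → G.formOwner α = pl → G.Derives α (g α)} {p : G.Play}
    (h : p.Conforms (G.positional pl g hg)) : p.Follows pl g := by
  cases p with
  | fin p =>
    refine List.isChain_iff_getElem.2 fun i hi ho => ?_
    have hd := List.isChain_iff_getElem.1 p.chain i hi
    have hl : p.positions.take (i + 1) = p.positions.take i ++ [p.positions[i]] := by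
      rw [List.take_concat_get']
    let q : G.FinPlay := ⟨p.positions.take (i + 1), by simpa using p.ne_nil, p.chain.take _⟩
    have hq : q.last = p.positions[i] := by
      simp only [q, FinPlay.last, hl, List.getLast_concat]
    have := h q p.positions[i + 1]
      (by change p.positions.take (i + 1) ++ _ <+: p.positions
          rw [List.take_concat_get']
          exact List.take_prefix _ _)
      (hq ▸ hd.not_isWord) (hq ▸ ho)
    exact this.symm.trans (congrArg g hq)
  | inf p hp =>
    intro i ho
    let q : G.FinPlay := ⟨(List.range (i + 1)).map p, by simp, by
      refine List.isChain_iff_getElem.2 fun j hj => ?_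
      simpa using hp j⟩
    have hq : q.last = p i := by simp [q, FinPlay.last, List.range_succ]
    have := h q (p (i + 1))
      (by simp [Play.HasPrefix, q, List.range_succ])
      (hq ▸ (hp i).not_isWord) (hq ▸ ho)
    exact this.symm.trans (congrArg g hq)

theorem invariant_getLast {P : Form T N → Prop} {R : Form T N → Form T N → Prop}
    (hR : ∀ α β, R α β → P α → P β) {l : List (Form T N)} (hl : l ≠ []) (hc : l.IsChain R)
    (h : P (l.head hl)) : P (l.getLast hl) := by
  induction l with
  | nil => exact (hl rfl).elim
  | cons a l ih =>
    cases l with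
    | nil => exact h
    | cons b l =>
      rw [List.isChain_cons_cons] at hc
      rw [List.getLast_cons_cons]
      exact ih (by simp) hc.2 (hR _ _ hc.1 h)

/-! ### Winning strategies of the two players -/

theorem mem_winningRegion_prover [Finite N] [Finite Q] {α : Form T N}
    (hα : α ∈ G.inclRegion A) : α ∈ G.winningRegion A Player.prover := by
  classical
  have hσ : G.system A (G.sol A) = G.sol A := (G.isLeast_sol A).1
  have hex : ∀ α : Form T N, ∃ β, ¬ IsWord α → G.Derives α β ∧
      (G.formOwner α = Player.prover → α ∈ G.inclRegion A → β ∈ G.inclRegion A) := by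
    intro α
    by_cases hw : IsWord α
    -- The value of `g` on a word is never used.
    · exact ⟨α, fun h => (h hw).elim⟩
    by_cases h : G.formOwner α = Player.prover ∧ α ∈ G.inclRegion A
    · have := h.2
      rw [inclRegion, Set.mem_ofPred_eq, BFE.IsRejecting, formSol,
        G.eval_formValue_prover A hσ hw h.1] at this
      push Not at this
      obtain ⟨β, hβ, k⟩ := this
      exact ⟨β, fun _ => ⟨hβ, fun _ _ => k⟩⟩
    · obtain ⟨β, hβ⟩ := G.exists_derives hw
      exact ⟨β, fun _ => ⟨hβ, fun h₁ h₂ => (h ⟨h₁, h₂⟩).elim⟩⟩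
  choose g hg using hex
  refine ⟨G.positional Player.prover g fun α hw _ => (hg α hw).1, fun p hmax hfirst hp => ?_⟩
  have hf := G.follows_of_conforms hp
  cases p with
  | inf p hp => trivial
  | fin p =>
    obtain ⟨w, hw⟩ := hmax
    have hlast : p.last ∈ G.inclRegion A := by
      refine invariant_getLast (P := (· ∈ G.inclRegion A))
        (R := fun α β => G.Derives α β ∧ (G.formOwner α = Player.prover → β = g α))
        ?_ p.ne_nil ?_ (by rwa [← hfirst] at hα)
      · rintro α β ⟨hd, hc⟩ hα
        cases ho : G.formOwner α with
        | prover => exact hc ho ▸ (hg α hd.not_isWord).2 ho hα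
        | refuter =>
          -- Refuter cannot leave the region: one rejecting successor would make the disjunction at
          -- `α` rejecting.
          exact fun hβ => hα ((G.eval_formValue_refuter A hσ hd.not_isWord ho _).2 ⟨β, hd, hβ⟩)
      · exact List.isChain_iff_getElem.2 fun i hi =>
          ⟨List.isChain_iff_getElem.1 p.chain i hi, List.isChain_iff_getElem.1 hf i hi⟩
    refine ⟨w, ?_, hw⟩
    rw [hw, inclRegion, Set.mem_ofPred_eq, BFE.IsRejecting, formSol, formValue_word,
      BFE.eval_ofBox, isRejectingBox_wordBox] at hlast
    exact not_not.1 hlast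

/-- The attractor rank strictly decreases along conforming plays, which excludes infinite ones; a
finite maximal play ends in a word of the attractor, and such a word is not accepted. -/
theorem mem_winningRegion_refuter {α : Form T N} (hα : ∃ n, G.Attractor A n α) :
    α ∈ G.winningRegion A Player.refuter := by
  classical
  have hex : ∀ α : Form T N, ∃ β, ¬ IsWord α → G.Derives α β ∧
      (G.formOwner α = Player.refuter → ∀ n, G.Attractor A n α →
        ∃ m < n, G.Attractor A m β) := by
    intro α
    by_cases hw : IsWord α
    · exact ⟨α, fun h => (h hw).elim⟩
    by_cases h : G.formOwner α = Player.refuter ∧ ∃ n, G.Attractor A n α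
    · obtain ⟨ho, hn⟩ := h
      -- The move is read off at the minimal rank `k + 1`: minimality rules out membership at stage
      -- `k`, so a successor at stage `k` exists, and `k` is below every rank `n` of `α`.
      have hmin := fun m => Nat.find_min hn (m := m)
      have hle := fun n => Nat.find_min' hn (m := n)
      have hs := Nat.find_spec hn
      cases hk : Nat.find hn with
      | zero =>
        rw [hk] at hs
        obtain ⟨w, -, hw'⟩ := hs
        exact (hw ⟨w, hw'⟩).elim
      | succ k =>
        rw [hk] at hs hmin hle
        obtain h | ⟨-, ⟨-, β, hβ, h⟩ | ⟨h, -⟩⟩ := hs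
        · exact (hmin k k.lt_succ_self h).elim
        · exact ⟨β, fun _ => ⟨hβ, fun _ n hn => ⟨k, hle n hn, h⟩⟩⟩
        · simp [ho] at h
    · obtain ⟨β, hβ⟩ := G.exists_derives hw
      exact ⟨β, fun _ => ⟨hβ, fun h₁ n h₂ => (h ⟨h₁, n, h₂⟩).elim⟩⟩
  choose g hg using hex
  have hprover : ∀ n α β, G.Derives α β → G.formOwner α = Player.prover →
      G.Attractor A n α → ∃ m < n, G.Attractor A m β := by
    intro n α β hd ho
    induction n with
    | zero => exact fun ⟨w, _, hw⟩ => (hd.not_isWord ⟨w, hw⟩).elim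
    | succ n ih =>
      rintro (h | ⟨-, ⟨h, -⟩ | ⟨-, h⟩⟩)
      · obtain ⟨m, hm, k⟩ := ih h
        exact ⟨m, hm.trans n.lt_succ_self, k⟩
      · simp [ho] at h
      · exact ⟨n, n.lt_succ_self, h β hd⟩
  have hstep : ∀ n α β, G.Derives α β → (G.formOwner α = Player.refuter → β = g α) →
      G.Attractor A n α → ∃ m < n, G.Attractor A m β := by
    intro n α β hd hc hn
    cases ho : G.formOwner α with
    | prover => exact hprover n α β hd ho hn
    | refuter => exact hc ho ▸ (hg α hd.not_isWord).2 ho n hn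
  refine ⟨G.positional Player.refuter g fun α hw _ => (hg α hw).1, fun p hmax hfirst hp => ?_⟩
  have hf := G.follows_of_conforms hp
  cases p with
  | inf p hd =>
    have hno : ∀ n i, ¬ G.Attractor A n (p i) := by
      intro n
      induction n using Nat.strong_induction_on with
      | _ n ih =>
        intro i hi
        obtain ⟨m, hm, k⟩ := hstep n _ _ (hd i) (hf i) hi
        exact ih m hm (i + 1) k
    obtain ⟨n, hn⟩ := hα
    exact hno n 0 (by rwa [← hfirst] at hn)
  | fin p =>
    obtain ⟨w, hw⟩ := hmax
    have hlast : ∃ n, G.Attractor A n p.last := by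
      refine invariant_getLast (P := fun α => ∃ n, G.Attractor A n α)
        (R := fun α β => G.Derives α β ∧ (G.formOwner α = Player.refuter → β = g α))
        ?_ p.ne_nil ?_ (by rwa [← hfirst] at hα)
      · rintro α β ⟨hd, hc⟩ ⟨n, hn⟩
        obtain ⟨m, -, hm⟩ := hstep n α β hd hc hn
        exact ⟨m, hm⟩
      · exact List.isChain_iff_getElem.2 fun i hi =>
          ⟨List.isChain_iff_getElem.1 p.chain i hi, List.isChain_iff_getElem.1 hf i hi⟩
    obtain ⟨n, hn⟩ := hlast
    -- Later stages add only forms that are not words, so a word in the attractor already lies in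
    -- stage 0.
    induction n with
    | zero => exact hn
    | succ n ih =>
      obtain h | ⟨h, -⟩ := hn
      · exact ih h
      · exact (h ⟨w, hw⟩).elim

/-! ## At most one player wins -/

variable {G} in
/-- The play that extends a finite play by one position. -/
def FinPlay.snoc (q : G.FinPlay) (β : Form T N) (h : G.Derives q.last β) : G.FinPlay where
  positions := q.positions ++ [β]
  ne_nil := by simp
  chain := by
    refine q.chain.append (.singleton β) ?_
    intro x hx y hy
    rw [List.getLast?_eq_some_getLast q.ne_nil] at hx
    simp only [List.head?_cons, Option.mem_def, Option.some.injEq] at hx hy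
    subst hx hy
    exact h

variable {G} in
theorem FinPlay.last_snoc (q : G.FinPlay) (β : Form T N) (h : G.Derives q.last β) :
    (q.snoc β h).last = β := by
  simp [FinPlay.last, FinPlay.snoc]

variable {G} in
open Classical in
/-- The finite play after `n` further moves according to two strategies, or up to a word. -/
noncomputable def jointPlay (sP : G.Strategy Player.prover) (sR : G.Strategy Player.refuter)
    (α : Form T N) : ℕ → G.FinPlay
  | 0 => ⟨[α], by simp, .singleton α⟩
  | n + 1 =>
    let q := jointPlay sP sR α n
    if hq : IsWord q.last then q else
      match ho : G.formOwner q.last with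
      | Player.prover => q.snoc (sP q hq ho) (sP q hq ho).2
      | Player.refuter => q.snoc (sR q hq ho) (sR q hq ho).2

variable {G} in
theorem jointPlay_succ (sP : G.Strategy Player.prover) (sR : G.Strategy Player.refuter)
    (α : Form T N) {n : ℕ} (h : ¬ IsWord (jointPlay sP sR α n).last) :
    ∃ (β : Form T N) (hβ : G.Derives (jointPlay sP sR α n).last β),
      jointPlay sP sR α (n + 1) = (jointPlay sP sR α n).snoc β hβ ∧
      (∀ ho, (sP (jointPlay sP sR α n) h ho : Form T N) = β) ∧
      ∀ ho, (sR (jointPlay sP sR α n) h ho : Form T N) = β := by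
  rw [jointPlay]
  simp only [h, dite_false]
  split
  next ho =>
    exact ⟨_, (sP _ h ho).2, rfl, fun _ => rfl, fun ho' => by simp [ho] at ho'⟩
  next ho =>
    exact ⟨_, (sR _ h ho).2, rfl, fun ho' => by simp [ho] at ho', fun _ => rfl⟩

-- Each stage extends the previous one, so until a word is reached all stages are prefixes of the
-- single sequence of last positions.
variable {G} in
theorem jointPlay_positions (sP : G.Strategy Player.prover) (sR : G.Strategy Player.refuter)
    (α : Form T N) {n : ℕ} (h : ∀ m < n, ¬ IsWord (jointPlay sP sR α m).last) :
    (jointPlay sP sR α n).positions =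
      (List.range (n + 1)).map fun i => (jointPlay sP sR α i).last := by
  induction n with
  | zero => rfl
  | succ n ih =>
    obtain ⟨β, hβ, k, -⟩ := jointPlay_succ sP sR α (h n n.lt_succ_self)
    rw [List.range_succ, List.map_append, ← ih fun m hm => h m (hm.trans n.lt_succ_self)]
    simp only [List.map_cons, List.map_nil, k, FinPlay.last_snoc]
    rfl

-- A prefix `q` of the joint sequence is itself a stage, so the position after it is the answer of
-- the strategy whose turn it is. The bound `n` serves both cases: the first stage ending in a word,
-- or any length if there is none.
variable {G} in
theorem jointPlay_conforms (sP : G.Strategy Player.prover) (sR : G.Strategy Player.refuter)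
    (α : Form T N) {n : ℕ} (h : ∀ m < n, ¬ IsWord (jointPlay sP sR α m).last)
    (q : G.FinPlay) (β : Form T N) (hn : q.positions.length ≤ n)
    (hq : q.positions ++ [β] = (List.range (q.positions ++ [β]).length).map
      fun i => (jointPlay sP sR α i).last) (hw : ¬ IsWord q.last) :
    (∀ ho, (sP q hw ho : Form T N) = β) ∧ ∀ ho, (sR q hw ho : Form T N) = β := by
  obtain ⟨m, hm⟩ : ∃ m, q.positions.length = m + 1 :=
    Nat.exists_eq_succ_of_ne_zero (by simpa using q.ne_nil)
  rw [List.length_append, hm, List.length_singleton, List.range_succ, List.map_append,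
    ← jointPlay_positions sP sR α fun j hj => h j (by omega)] at hq
  obtain ⟨h₁, h₂⟩ := List.append_inj' hq (by simp)
  have hqm : q = jointPlay sP sR α m := by
    cases q
    cases hj : jointPlay sP sR α m
    simp_all
  subst hqm
  obtain ⟨β', hβ, k, k₁, k₂⟩ := jointPlay_succ sP sR α hw
  have hβ' : β = β' := by simpa [k, FinPlay.last_snoc] using h₂
  subst hβ'
  exact ⟨k₁, k₂⟩

variable {G} in
theorem exists_joint_play (sP : G.Strategy Player.prover) (sR : G.Strategy Player.refuter)
    (α : Form T N) :
    ∃ p : G.Play, p.IsMaximal ∧ p.first = α ∧ p.Conforms sP ∧ p.Conforms sR := by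
  classical
  by_cases hfin : ∃ n, IsWord (jointPlay sP sR α n).last
  · have hmin : ∀ m < Nat.find hfin, ¬ IsWord (jointPlay sP sR α m).last :=
      fun m hm => Nat.find_min hfin hm
    have hpos := jointPlay_positions sP sR α hmin
    have hpre : ∀ (q : G.FinPlay) (β : Form T N),
        (Play.fin (jointPlay sP sR α (Nat.find hfin))).HasPrefix (q.positions ++ [β]) →
        q.positions.length ≤ Nat.find hfin ∧
        q.positions ++ [β] = (List.range (q.positions ++ [β]).length).map
          fun i => (jointPlay sP sR α i).last := by
      intro q β h
      change q.positions ++ [β] <+: (jointPlay sP sR α (Nat.find hfin)).positions at h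
      rw [hpos] at h
      have hlen := h.length_le
      simp only [List.length_append, List.length_singleton, List.length_map,
        List.length_range] at hlen
      refine ⟨by omega, (List.prefix_iff_eq_take.1 h).trans ?_⟩
      rw [← List.map_take, List.take_range, Nat.min_eq_left]
      simpa using hlen
    refine ⟨.fin (jointPlay sP sR α (Nat.find hfin)), Nat.find_spec hfin, ?_, ?_, ?_⟩
    · change (jointPlay sP sR α (Nat.find hfin)).positions.head _ = α
      rw [List.head_eq_iff_head?_eq_some, hpos, List.range_succ_eq_map]
      rfl
    · intro q β hq hw ho
      obtain ⟨h₁, h₂⟩ := hpre q β hq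
      exact (jointPlay_conforms sP sR α hmin q β h₁ h₂ hw).1 ho
    · intro q β hq hw ho
      obtain ⟨h₁, h₂⟩ := hpre q β hq
      exact (jointPlay_conforms sP sR α hmin q β h₁ h₂ hw).2 ho
  · have hno : ∀ n, ¬ IsWord (jointPlay sP sR α n).last := fun n h => hfin ⟨n, h⟩
    refine ⟨.inf (fun i => (jointPlay sP sR α i).last) fun i => ?_, trivial, rfl, ?_, ?_⟩
    · obtain ⟨β, hβ, k, -⟩ := jointPlay_succ sP sR α (hno i)
      rwa [k, FinPlay.last_snoc]
    · exact fun q β hq hw ho =>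
        (jointPlay_conforms sP sR α (fun m _ => hno m) q β le_rfl hq hw).1 ho
    · exact fun q β hq hw ho =>
        (jointPlay_conforms sP sR α (fun m _ => hno m) q β le_rfl hq hw).2 ho

/-- Winning strategies of both players from the same form would make their joint play satisfy both
conditions: it could not be infinite, and its final word would be both accepted and not accepted. -/
theorem disjoint_winningRegion :
    Disjoint (G.winningRegion A Player.prover) (G.winningRegion A Player.refuter) := by
  rw [Set.disjoint_left]
  rintro α ⟨sP, hP⟩ ⟨sR, hR⟩
  obtain ⟨p, hmax, hfirst, h₁, h₂⟩ := exists_joint_play sP sR α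
  have hi := hP p hmax hfirst h₁
  have hn := hR p hmax hfirst h₂
  cases p with
  | inf p hp => exact hn
  | fin p =>
    obtain ⟨w, hw, k⟩ := hi
    obtain ⟨w', hw', k'⟩ := hn
    exact hw' (word_injective (k.symm.trans k') ▸ hw)

/-! ### Determinacy: the winning regions computed by the least solution -/

theorem winningRegion_prover_eq [Finite N] [Finite Q] :
    G.winningRegion A Player.prover = G.inclRegion A :=
  Set.Subset.antisymm
    (fun _ hα h => Set.disjoint_left.1 (G.disjoint_winningRegion A) hα
      (G.mem_winningRegion_refuter A (G.exists_attractor_of_mem_nonInclRegion A h)))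
    fun _ => G.mem_winningRegion_prover A

theorem winningRegion_refuter_eq [Finite N] [Finite Q] :
    G.winningRegion A Player.refuter = G.nonInclRegion A :=
  Set.Subset.antisymm
    (fun _ hα => not_not.1 fun h => Set.disjoint_left.1 (G.disjoint_winningRegion A)
      (G.mem_winningRegion_prover A h) hα)
    fun _ h => G.mem_winningRegion_refuter A (G.exists_attractor_of_mem_nonInclRegion A h)

end OwnedCFG

end InclusionGame

theorem mainTheorem1 {T N Q : Type*} [Finite T] [Finite N] [Finite Q]
    (G : InclusionGame.OwnedCFG T N) (A : NFA T Q) :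
    -- `σ` is the least solution, and it is reached by finitely many iterations
    (IsLeast (Function.fixedPoints (G.system A)) (G.sol A) ∧
      ∃ n : ℕ, ∀ i ≥ n, (G.system A)^[i] ⊥ = G.sol A) ∧
    -- the sentential forms split into two disjoint sets
    G.inclRegion A ∪ G.nonInclRegion A = Set.univ ∧
    Disjoint (G.inclRegion A) (G.nonInclRegion A) ∧
    -- which are the winning regions of the players
    G.winningRegion A InclusionGame.Player.prover = G.inclRegion A ∧
    G.winningRegion A InclusionGame.Player.refuter = G.nonInclRegion A ∧
    -- so the winner from `α` is found by evaluating the formula of `α`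
    ∀ α : InclusionGame.Form T N,
      (α ∈ G.winningRegion A InclusionGame.Player.refuter ↔
        (G.formSol A α).eval (InclusionGame.IsRejectingBox A)) ∧
      (α ∈ G.winningRegion A InclusionGame.Player.prover ↔
        ¬ (G.formSol A α).eval (InclusionGame.IsRejectingBox A)) := by
  have hP := G.winningRegion_prover_eq A
  have hR := G.winningRegion_refuter_eq A
  refine ⟨⟨G.isLeast_sol A, G.exists_iterate_eq_sol A⟩, ?_, ?_, hP, hR, fun α => ⟨?_, ?_⟩⟩
  · exact Set.eq_univ_of_forall fun α => (em _).symm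
  · exact Set.disjoint_left.2 fun α h h' => h h'
  · rw [hR]
    rfl
  · rw [hP]
    rfl
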